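/- Let $(X,d)$ be a proper geodesic metric space which is Gromov hyperbolic, i.e. there is $\delta\ge 0$ such that each side of every geodesic triangle in $X$ is contained in the $\delta$-neighbourhood of the union of the two other sides. Let $\partial_G X$ be its Gromov boundary, i.e. the set of geodesic rays $[0,\infty)\to X$ issuing from a fixed base point $x_0\in X$, modulo the relation of being at bounded distance from each other, and let $\overline{X}^G = X\cup\partial_G X$ be the Gromov compactification of $X$. Let $f,g:X\to X$ be 1-Lipschitz maps with $f\circ g=g\circ f$. Suppose that there are points $\xi_f,\xi_g\in\partial_G X$ with $\xi_f\ne\xi_g$ such that, for every $x\in X$, $$\lim_{n\to\infty} f^n(x)=\xi_f \quad\text{and}\quad \lim_{n\to\infty} g^n(x)=\xi_g$$ in $\overline{X}^G$, where $f^n$ and $g^n$ denote the $n$-th iterates. Then there exists a compact set $K\subset X$ such that for every integer $m\ge 0$ there exists an integer $n=n(m)\ge 0$ with $$K\cap f^m\bigl(g^n(K)\bigr)\neq\emptyset .$$ -/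

import Mathlib

open Filter Topology Set
open scoped NNReal

namespace GromovHyp

/-- The restriction of `γ` to `I` is an isometric embedding; for an interval `I` of `ℝ`
(or of `ℝ≥0`) this says that `γ` restricted to `I` is a geodesic. -/
def IsGeodesicOn {α X : Type*} [PseudoMetricSpace α] [PseudoMetricSpace X]
    (γ : α → X) (I : Set α) : Prop :=
  ∀ s ∈ I, ∀ t ∈ I, dist (γ s) (γ t) = dist s t

/-- Any two points are joined by a geodesic segment. -/
def IsGeodesicSpace (X : Type*) [MetricSpace X] : Prop :=
  ∀ x y : X, ∃ (a b : ℝ) (γ : ℝ → X),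
    a ≤ b ∧ IsGeodesicOn γ (Icc a b) ∧ γ a = x ∧ γ b = y

/-- There is `δ ≥ 0` such that every geodesic triangle is `δ`-thin: each side is contained in the
`δ`-neighbourhood of the union of the two other sides. Indices are taken modulo `3`. -/
def IsHyperbolic (X : Type*) [MetricSpace X] : Prop :=
  ∃ δ : ℝ, 0 ≤ δ ∧ ∀ (a b : Fin 3 → ℝ) (γ : Fin 3 → ℝ → X),
    (∀ i, a i < b i) →
    (∀ i, IsGeodesicOn (γ i) (Icc (a i) (b i))) →
    (∀ i, γ i (b i) = γ (i + 1) (a (i + 1))) →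
    ∀ i, ∀ t ∈ Icc (a i) (b i),
      ∃ j, j ≠ i ∧ ∃ s ∈ Icc (a j) (b j), dist (γ i t) (γ j s) ≤ δ

section

variable {X : Type*} [MetricSpace X]

/-- Geodesic rays `[0, ∞) → X` issuing from `x₀`, with the topology of uniform convergence on
compact sets (the compact-open topology of `C(ℝ≥0, X)`). -/
abbrev GeodesicRay (x₀ : X) : Type _ :=
  {γ : C(ℝ≥0, X) // Isometry γ ∧ γ 0 = x₀}

/-- Two rays are equivalent when they stay at bounded distance from each other. -/
instance rayEquiv (x₀ : X) : Setoid (GeodesicRay x₀) where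
  r γ η := ∃ C : ℝ, ∀ t : ℝ≥0, dist (γ.1 t) (η.1 t) ≤ C
  iseqv :=
    { refl := fun γ => ⟨0, fun t => (dist_self (γ.1 t)).le⟩
      symm := fun ⟨C, hC⟩ => ⟨C, fun t => by rw [dist_comm]; exact hC t⟩
      trans := fun ⟨C, hC⟩ ⟨D, hD⟩ =>
        ⟨C + D, fun t => (dist_triangle _ _ _).trans (add_le_add (hC t) (hD t))⟩ }

/-- The Gromov boundary, as the space of classes of rays from `x₀` (with the quotient topology). -/
abbrev GromovBoundary (x₀ : X) : Type _ := Quotient (rayEquiv x₀)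

/-- The Gromov closure `X ∪ ∂X`. -/
inductive GromovClosure (x₀ : X) where
  | point (x : X) : GromovClosure x₀
  | ideal (ξ : GromovBoundary x₀) : GromovClosure x₀

/-- `σ` is a geodesic from `x₀` with `End σ = p`. If `p` is a point of `X`, then `σ` is a geodesic
segment `[0, R] → X` from `x₀` to `p`, continued by the constant `p` on `[R, ∞)`; if `p` is a
boundary point, then `σ` is a geodesic ray from `x₀` in the class `p`. -/
def IsGeodesicTo (x₀ : X) (σ : C(ℝ≥0, X)) : GromovClosure x₀ → Prop
  | .point y => ∃ R : ℝ≥0, IsGeodesicOn σ (Iic R) ∧ σ 0 = x₀ ∧ ∀ t, R ≤ t → σ t = y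
  | .ideal ξ => ∃ h : Isometry σ ∧ σ 0 = x₀, Quotient.mk (rayEquiv x₀) ⟨σ, h⟩ = ξ

/-- Convergence of sequences in the Gromov closure: for every choice of geodesics `σ n` from `x₀`
with `End (σ n) = u n`, every subsequence of `σ` has a subsequence that converges locally uniformly
to a geodesic `τ` with `End τ = p`. -/
def SeqConverges (x₀ : X) (u : ℕ → GromovClosure x₀) (p : GromovClosure x₀) : Prop :=
  ∀ σ : ℕ → C(ℝ≥0, X), (∀ n, IsGeodesicTo x₀ (σ n) (u n)) →
    ∀ φ : ℕ → ℕ, StrictMono φ → ∃ ψ : ℕ → ℕ, StrictMono ψ ∧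
      ∃ τ : C(ℝ≥0, X), IsGeodesicTo x₀ τ p ∧
        Tendsto (fun k => σ (φ (ψ k))) atTop (𝓝 τ)

/-- The topology of the Gromov compactification, determined by its convergent sequences: a set is
open when every sequence converging to one of its points is eventually in it. -/
instance (x₀ : X) : TopologicalSpace (GromovClosure x₀) where
  IsOpen U := ∀ (u : ℕ → GromovClosure x₀) (p : GromovClosure x₀),
    p ∈ U → SeqConverges x₀ u p → ∀ᶠ n in atTop, u n ∈ U
  isOpen_univ := fun _ _ _ _ => Eventually.of_forall fun _ => mem_univ _
  isOpen_inter := fun _ _ hU hV u p hp hu => (hU u p hp.1 hu).and (hV u p hp.2 hu)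
  isOpen_sUnion := fun _ hS u p ⟨U, hUS, hpU⟩ hu =>
    (hS U hUS u p hpU hu).mono fun _ hn => ⟨U, hUS, hn⟩

end

end GromovHyp

/-! Put p = f^m(x₀), q = g^n(x₀), w = f^m(g^n(x₀)). As f and g commute and are 1-Lipschitz, d(w,p) ≤
d(x₀,q) and d(w,q) ≤ d(x₀,p). Distinct limits bound the Gromov products of the two orbits
(`exists_gromovProduct_le`), so a geodesic from p to q has a point u whose distances to p and q fall
short of d(x₀,p) and d(x₀,q) by at most a constant. If n is chosen so that d(x₀,q) and d(x₀,p) are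
nearly equal, thinness (`exists_dist_le_add_max`) puts both x₀ and w near u, hence w near x₀. -/

namespace GromovHyp

/-! ### Thin triangles and distance to a point of a side. -/

theorem IsGeodesicOn.dist_eq_sub {X : Type*} [MetricSpace X] {γ : ℝ → X} {a b s t : ℝ}
    (h : IsGeodesicOn γ (Icc a b)) (has : a ≤ s) (hst : s ≤ t) (htb : t ≤ b) :
    dist (γ s) (γ t) = t - s := by
  rw [h s ⟨has, hst.trans htb⟩ t ⟨has.trans hst, htb⟩, dist_comm, Real.dist_eq,
    abs_of_nonneg (sub_nonneg.2 hst)]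

/-- In a hyperbolic geodesic space the distance from `w` to a point `u` of a geodesic from `p` to
`q` is controlled by the distances to the endpoints. -/
theorem exists_dist_le_add_max {X : Type*} [MetricSpace X] (hgeod : IsGeodesicSpace X)
    (hhyp : IsHyperbolic X) :
    ∃ δ : ℝ, 0 ≤ δ ∧ ∀ w p q u : X, dist p u + dist u q = dist p q →
      dist w u ≤ δ + max (dist w p - dist p u) (dist w q - dist u q) := by
  obtain ⟨δ, hδ, H⟩ := hhyp
  refine ⟨2 * δ, by positivity, fun w p q u hu => ?_⟩
  -- `IsHyperbolic` speaks only of triangles with sides of positive length, so coinciding vertices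
  -- are treated apart.
  rcases eq_or_ne p q with rfl | hpq
  · have h1 : dist p u = 0 := by
      have := dist_self p
      have := @dist_nonneg _ _ p u
      have := @dist_nonneg _ _ u p
      linarith
    have h2 := dist_triangle w p u
    have := le_max_left (dist w p - dist p u) (dist w p - dist u p)
    linarith
  rcases eq_or_ne q w with rfl | hqw
  · have := le_max_left (dist q p - dist p u) (dist q q - dist u q)
    have := dist_comm q p
    have := dist_comm q u
    linarith
  rcases eq_or_ne w p with rfl | hwp
  · have := le_max_right (dist w w - dist w u) (dist w q - dist u q)
    linarith
  obtain ⟨a₁, b₁, γ₁, hab₁, hγ₁, hs₁, ht₁⟩ := hgeod q w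
  obtain ⟨a₂, b₂, γ₂, hab₂, hγ₂, hs₂, ht₂⟩ := hgeod w p
  obtain ⟨c, d, η, hcd, hη, hηc, hηd⟩ := hgeod p u
  obtain ⟨c', d', η', hcd', hη', hηc', hηd'⟩ := hgeod u q
  have hpu : dist p u = d - c := by
    rw [← hηc, ← hηd, hη.dist_eq_sub le_rfl hcd le_rfl]
  have huq : dist u q = d' - c' := by
    rw [← hηc', ← hηd', hη'.dist_eq_sub le_rfl hcd' le_rfl]
  have hlt₁ : a₁ < b₁ := lt_of_le_of_ne hab₁ fun h => hqw (by rw [← hs₁, ← ht₁, h])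
  have hlt₂ : a₂ < b₂ := lt_of_le_of_ne hab₂ fun h => hwp (by rw [← hs₂, ← ht₂, h])
  -- The side must pass through u, so it is glued from geodesics [p,u] and [u,q]; equality in the
  -- triangle inequality makes the result geodesic.
  set γ₀ : ℝ → X := fun t => if t ≤ dist p u then η (c + t) else η' (c' + (t - dist p u)) with hγ₀
  have hcross : ∀ s t : ℝ, 0 ≤ s → s ≤ dist p u → dist p u < t → t ≤ dist p q →
      dist (η (c + s)) (η' (c' + (t - dist p u))) = t - s := by
    intro s t hs0 hsu hut htq
    have e1 := hη.dist_eq_sub (s := c) (t := c + s) le_rfl (by linarith) (by linarith)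
    have e2 := hη.dist_eq_sub (s := c + s) (t := d) (by linarith) (by linarith) le_rfl
    have e3 := hη'.dist_eq_sub (s := c') (t := c' + (t - dist p u)) le_rfl (by linarith)
      (by linarith)
    have e4 := hη'.dist_eq_sub (s := c' + (t - dist p u)) (t := d') (by linarith) (by linarith)
      le_rfl
    rw [hηc] at e1
    rw [hηd] at e2
    rw [hηc'] at e3
    rw [hηd'] at e4
    have t1 := dist_triangle (η (c + s)) u (η' (c' + (t - dist p u)))
    have t2 := dist_triangle4 p (η (c + s)) (η' (c' + (t - dist p u))) q
    linarith
  have hgeo₀ : IsGeodesicOn γ₀ (Icc 0 (dist p q)) := by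
    rintro s ⟨hs0, hs⟩ t ⟨ht0, ht⟩
    simp only [hγ₀]
    split_ifs with h1 h2 h2
    · rw [hη _ ⟨by linarith, by linarith⟩ _ ⟨by linarith, by linarith⟩, Real.dist_eq, Real.dist_eq]
      congr 1; ring
    · push Not at h2
      rw [hcross s t hs0 h1 h2 ht, dist_comm, Real.dist_eq, abs_of_nonneg (by linarith)]
    · push Not at h1
      rw [dist_comm, hcross t s ht0 h2 h1 hs, Real.dist_eq, abs_of_nonneg (by linarith)]
    · push Not at h1 h2
      rw [hη' _ ⟨by linarith, by linarith⟩ _ ⟨by linarith, by linarith⟩, Real.dist_eq, Real.dist_eq]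
      congr 1; ring
  have hγ₀0 : γ₀ 0 = p := by simp [hγ₀, hηc]
  have hγ₀u : γ₀ (dist p u) = u := by simp [hγ₀, hpu, hηd]
  have hγ₀L : γ₀ (dist p q) = q := by
    simp only [hγ₀]
    split_ifs with h
    · have : dist u q = 0 := by linarith [@dist_nonneg _ _ u q]
      rw [← dist_eq_zero.1 this, show c + dist p u = d by linarith, hηd]
    · rw [← hu, show c' + (dist p u + dist u q - dist p u) = d' by linarith, hηd']
  have key := H ![0, a₁, a₂] ![dist p q, b₁, b₂] ![γ₀, γ₁, γ₂]
    (by intro i; fin_cases i <;> simp <;> first | exact hpq | assumption)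
    (by intro i; fin_cases i <;> simp <;> assumption)
    (by intro i; fin_cases i; exacts [hγ₀L.trans hs₁.symm, ht₁.trans hs₂.symm, ht₂.trans hγ₀0.symm])
    0 (dist p u) ⟨by simp, by simpa using by linarith [@dist_nonneg _ _ u q]⟩
  obtain ⟨j, hj, s, hs, hd⟩ := key
  have hd' : j = 1 ∨ j = 2 := by
    revert hj; fin_cases j <;> simp
  rcases hd' with rfl | rfl
  -- With v = `γ₁ s` within δ of u: d(w,u) ≤ d(w,v) + δ and d(w,v) = d(w,q) - d(v,q) ≤ d(w,q) -
  -- d(u,q) + δ, whence the constant 2δ.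
  · simp only [Matrix.cons_val_zero, Matrix.cons_val_one, hγ₀u] at hd hs
    have e1 : dist q (γ₁ s) + dist (γ₁ s) w = dist q w := by
      have h1 := hγ₁.dist_eq_sub le_rfl hs.1 hs.2
      have h2 := hγ₁.dist_eq_sub hs.1 hs.2 le_rfl
      have h3 := hγ₁.dist_eq_sub le_rfl hab₁ le_rfl
      rw [hs₁] at h1 h3
      rw [ht₁] at h2 h3
      linarith
    have t1 := dist_triangle w (γ₁ s) u
    have t2 := dist_triangle u (γ₁ s) q
    rw [dist_comm (γ₁ s) u, dist_comm w (γ₁ s)] at t1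
    rw [dist_comm (γ₁ s) q] at t2
    rw [dist_comm q w] at e1
    have := le_max_right (dist w p - dist p u) (dist w q - dist u q)
    linarith
  · simp only [Matrix.cons_val_zero, Matrix.cons_val, hγ₀u] at hd hs
    have e1 : dist w (γ₂ s) + dist (γ₂ s) p = dist w p := by
      have h1 := hγ₂.dist_eq_sub le_rfl hs.1 hs.2
      have h2 := hγ₂.dist_eq_sub hs.1 hs.2 le_rfl
      have h3 := hγ₂.dist_eq_sub le_rfl hab₂ le_rfl
      rw [hs₂] at h1 h3
      rw [ht₂] at h2 h3
      linarith
    have t1 := dist_triangle w (γ₂ s) u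
    have t2 := dist_triangle p (γ₂ s) u
    rw [dist_comm (γ₂ s) u] at t1 t2
    rw [dist_comm p (γ₂ s)] at t2
    have := le_max_left (dist w p - dist p u) (dist w q - dist u q)
    linarith

/-! ### Geodesic segments from the base point, extended by constants. -/

section

variable {X : Type*} [MetricSpace X]

/-- `σ` parametrises by arc length a geodesic segment of length `r` from `x₀`, and is constant
afterwards. -/
def IsSegment (x₀ : X) (σ : C(ℝ≥0, X)) (r : ℝ) : Prop :=
  0 ≤ r ∧ σ 0 = x₀ ∧ ∀ s t : ℝ≥0, dist (σ s) (σ t) = |min (s : ℝ) r - min (t : ℝ) r|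

theorem IsSegment.lipschitzWith {x₀ : X} {σ : C(ℝ≥0, X)} {r : ℝ} (h : IsSegment x₀ σ r) :
    LipschitzWith 1 σ := by
  refine LipschitzWith.of_dist_le_mul fun s t => ?_
  rw [h.2.2, NNReal.coe_one, one_mul, NNReal.dist_eq]
  simpa using abs_min_sub_min_le_max (s : ℝ) r (t : ℝ) r

theorem IsSegment.dist_base {x₀ : X} {σ : C(ℝ≥0, X)} {r : ℝ} (h : IsSegment x₀ σ r) (t : ℝ≥0) :
    dist x₀ (σ t) = min (t : ℝ) r := by
  have h1 := h.2.2 0 t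
  rw [h.2.1] at h1
  have h2 : 0 ≤ min (t : ℝ) r := le_min t.2 h.1
  rw [h1, NNReal.coe_zero, min_eq_left h.1, zero_sub, abs_neg, abs_of_nonneg h2]

theorem isSegment_of_isGeodesicTo_point {x₀ y : X} {σ : C(ℝ≥0, X)}
    (h : IsGeodesicTo x₀ σ (.point y)) : IsSegment x₀ σ (dist x₀ y) := by
  obtain ⟨R, hR, h0, hy⟩ := h
  have hd : dist x₀ y = R := by
    rw [← h0, ← hy R le_rfl, hR 0 (mem_Iic.2 zero_le) R (mem_Iic.2 le_rfl), NNReal.dist_eq]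
    simp
  refine ⟨dist_nonneg, h0, fun s t => ?_⟩
  have hmin : ∀ s : ℝ≥0, σ s = σ (min s R) := fun s => by
    rcases le_total s R with h | h
    · rw [min_eq_left h]
    · rw [min_eq_right h, hy s h, hy R le_rfl]
  rw [hmin s, hmin t, hR _ (mem_Iic.2 (min_le_right _ _)) _ (mem_Iic.2 (min_le_right _ _)), NNReal.dist_eq, hd]
  simp

theorem isGeodesicTo_point_of_isSegment {x₀ : X} {σ : C(ℝ≥0, X)} {r R : ℝ≥0}
    (h : IsSegment x₀ σ r) (hR : r ≤ R) : IsGeodesicTo x₀ σ (.point (σ R)) := by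
  refine ⟨r, fun s hs t ht => ?_, h.2.1, fun t ht => ?_⟩
  · rw [h.2.2, NNReal.dist_eq, min_eq_left (by exact_mod_cast hs), min_eq_left (by exact_mod_cast ht)]
  · rw [← dist_eq_zero, h.2.2, min_eq_right (by exact_mod_cast ht),
      min_eq_right (by exact_mod_cast hR), sub_self, abs_zero]

theorem not_isometry_of_isSegment {x₀ : X} {σ : C(ℝ≥0, X)} {r : ℝ} (h : IsSegment x₀ σ r) :
    ¬ Isometry σ := by
  intro hi
  obtain ⟨hr, -, hd⟩ := h
  lift r to ℝ≥0 using hr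
  have h1 := hd r (r + 1)
  rw [hi.dist_eq, NNReal.dist_eq] at h1
  simp at h1

theorem exists_isGeodesicTo_point (hgeod : IsGeodesicSpace X) (x₀ y : X) :
    ∃ σ : C(ℝ≥0, X), IsGeodesicTo x₀ σ (.point y) := by
  obtain ⟨a, b, γ, hab, hγ, ha, hb⟩ := hgeod x₀ y
  have hmem : ∀ t : ℝ≥0, a + min (t : ℝ) (b - a) ∈ Icc a b := fun t =>
    ⟨by linarith [le_min (NNReal.coe_nonneg t) (sub_nonneg.2 hab)], by linarith [min_le_right (t : ℝ) (b - a)]⟩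
  have hd : ∀ s t : ℝ≥0, dist (γ (a + min (s : ℝ) (b - a))) (γ (a + min (t : ℝ) (b - a))) =
      |min (s : ℝ) (b - a) - min (t : ℝ) (b - a)| := fun s t => by
    rw [hγ _ (hmem s) _ (hmem t), Real.dist_eq]
    congr 1; ring
  have hc : LipschitzWith 1 fun t : ℝ≥0 => γ (a + min (t : ℝ) (b - a)) := by
    refine LipschitzWith.of_dist_le_mul fun s t => ?_
    rw [hd, NNReal.coe_one, one_mul, NNReal.dist_eq]
    simpa using abs_min_sub_min_le_max (s : ℝ) (b - a) (t : ℝ) (b - a)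
  have hs : IsSegment x₀ ⟨_, hc.continuous⟩ (⟨b - a, sub_nonneg.2 hab⟩ : ℝ≥0) :=
    ⟨sub_nonneg.2 hab, by simp [min_eq_left (sub_nonneg.2 hab), ha], hd⟩
  have := isGeodesicTo_point_of_isSegment hs le_rfl
  refine ⟨⟨_, hc.continuous⟩, ?_⟩
  convert this using 2
  change y = γ (a + min (b - a) (b - a))
  rw [min_self, add_sub_cancel, hb]

theorem exists_isGeodesicTo (hgeod : IsGeodesicSpace X) (x₀ : X) (p : GromovClosure x₀) :
    ∃ σ : C(ℝ≥0, X), IsGeodesicTo x₀ σ p := by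
  cases p with
  | point y => exact exists_isGeodesicTo_point hgeod x₀ y
  | ideal ξ =>
    obtain ⟨γ, rfl⟩ := Quotient.exists_rep ξ
    exact ⟨γ.1, γ.2, rfl⟩

/-! ### Convergence to ideal points, tested on closed sets. -/

/-- The endpoints of a closed set of geodesics from `x₀` form a closed set. -/
theorem isClosed_setOf_isGeodesicTo (hgeod : IsGeodesicSpace X) (x₀ : X) {S : Set C(ℝ≥0, X)}
    (hS : IsClosed S) : IsClosed {p : GromovClosure x₀ | ∃ σ ∈ S, IsGeodesicTo x₀ σ p} := by
  rw [← isOpen_compl_iff]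
  intro u p hp hu
  by_contra hev
  have hfr : ∃ᶠ n in atTop, ∃ σ ∈ S, IsGeodesicTo x₀ σ (u n) := by
    intro h
    exact hev (h.mono fun n hn => hn)
  -- `SeqConverges` allows any choice of geodesics, so they are taken in `S` whenever possible.
  have hex : ∀ n, ∃ σ, IsGeodesicTo x₀ σ (u n) ∧ ((∃ σ ∈ S, IsGeodesicTo x₀ σ (u n)) → σ ∈ S) := by
    intro n
    by_cases h : ∃ σ ∈ S, IsGeodesicTo x₀ σ (u n)
    · obtain ⟨σ, h1, h2⟩ := h
      exact ⟨σ, h2, fun _ => h1⟩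
    · obtain ⟨σ, h1⟩ := exists_isGeodesicTo hgeod x₀ (u n)
      exact ⟨σ, h1, fun h' => absurd h' h⟩
  choose σ hσ hσS using hex
  obtain ⟨φ, hφ, hφS⟩ := extraction_of_frequently_atTop hfr
  obtain ⟨ψ, -, τ, hτ, hlim⟩ := hu σ hσ φ hφ
  exact hp ⟨τ, hS.mem_of_tendsto hlim (Eventually.of_forall fun k => hσS _ (hφS _)), hτ⟩

/-- A sequence converging to an ideal point is unbounded. -/
theorem exists_lt_dist_of_tendsto_ideal (hgeod : IsGeodesicSpace X) {x₀ : X} {y : ℕ → X}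
    {ξ : GromovBoundary x₀}
    (hy : Tendsto (fun n => GromovClosure.point (x₀ := x₀) (y n)) atTop (𝓝 (.ideal ξ))) (R : ℝ) :
    ∃ n, R < dist x₀ (y n) := by
  by_contra! hb
  have hR : 0 ≤ R := dist_nonneg.trans (hb 0)
  lift R to ℝ≥0 using hR
  -- Reading the length off as d(x₀, σ(R)) makes "segment of length at most R" a closed condition,
  -- which no ray satisfies.
  have hcl : IsClosed {σ : C(ℝ≥0, X) | IsSegment x₀ σ (dist x₀ (σ R))} := by
    have hev : ∀ t : ℝ≥0, Continuous fun σ : C(ℝ≥0, X) => σ t := fun t =>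
      continuous_eval_const t
    simp only [IsSegment, ofPred_and, ofPred_forall]
    refine (isClosed_le (by fun_prop) (by fun_prop)).inter
      ((isClosed_eq (by fun_prop) (by fun_prop)).inter
        (isClosed_iInter fun s => isClosed_iInter fun t => isClosed_eq (by fun_prop) (by fun_prop)))
  have hmem := (isClosed_setOf_isGeodesicTo hgeod x₀ hcl).mem_of_tendsto hy
    (Eventually.of_forall fun n => by
      obtain ⟨σ, hσ⟩ := exists_isGeodesicTo_point hgeod x₀ (y n)
      have hs := isSegment_of_isGeodesicTo_point hσ
      refine ⟨σ, ?_, hσ⟩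
      have := hs.dist_base R
      rw [min_eq_right (hb n)] at this
      rw [mem_ofPred_eq, this]
      exact hs)
  obtain ⟨σ, hσ, h, -⟩ := hmem
  exact not_isometry_of_isSegment hσ h.1

/-- Limits of geodesics to the points of a sequence that converges to `ξ` are rays in the
class `ξ`. -/
theorem isGeodesicTo_ideal_of_tendsto (hgeod : IsGeodesicSpace X) {x₀ : X} {y : ℕ → X}
    {ξ : GromovBoundary x₀}
    (hy : Tendsto (fun n => GromovClosure.point (x₀ := x₀) (y n)) atTop (𝓝 (.ideal ξ)))
    {φ : ℕ → ℕ} (hφ : Tendsto φ atTop atTop) {σ : ℕ → C(ℝ≥0, X)}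
    (hσ : ∀ k, IsGeodesicTo x₀ (σ k) (.point (y (φ k)))) {τ : C(ℝ≥0, X)}
    (hτ : Tendsto σ atTop (𝓝 τ)) : IsGeodesicTo x₀ τ (.ideal ξ) := by
  -- The closed set is the sequence with its limit; its terms are eventually constant, so only `τ`
  -- can be a ray.
  obtain ⟨s, hs, hsξ⟩ := (isClosed_setOf_isGeodesicTo hgeod x₀
    hτ.isCompact_insert_range.isClosed).mem_of_tendsto (hy.comp hφ)
    (Eventually.of_forall fun k => ⟨σ k, mem_insert_of_mem _ (mem_range_self k), hσ k⟩)
  rcases hs with rfl | ⟨k, rfl⟩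
  · exact hsξ
  · exact absurd hsξ.1.1 (not_isometry_of_isSegment (isSegment_of_isGeodesicTo_point (hσ k)))

/-! ### Compactness and bounded Gromov products. -/

theorem isCompact_setOf_lipschitzWith [ProperSpace X] (x₀ : X) :
    IsCompact {σ : C(ℝ≥0, X) | LipschitzWith 1 σ ∧ σ 0 = x₀} := by
  refine ArzelaAscoli.isCompact_of_equicontinuous _ ?_ ?_
  · have himage : ContinuousMap.toFun '' {σ : C(ℝ≥0, X) | LipschitzWith 1 σ ∧ σ 0 = x₀} =
        {σ : ℝ≥0 → X | LipschitzWith 1 σ ∧ σ 0 = x₀} := by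
      ext σ
      exact ⟨by rintro ⟨σ, h, rfl⟩; exact h, fun h => ⟨⟨σ, h.1.continuous⟩, h, rfl⟩⟩
    rw [himage]
    refine (isCompact_univ_pi fun t : ℝ≥0 =>
      isCompact_closedBall x₀ (t : ℝ)).of_isClosed_subset ?_ ?_
    · simp only [lipschitzWith_iff_dist_le_mul, ofPred_and, ofPred_forall]
      exact (isClosed_iInter fun s => isClosed_iInter fun t =>
        isClosed_le (by fun_prop) (by fun_prop)).inter (isClosed_eq (by fun_prop) (by fun_prop))
    · rintro σ ⟨h, h0⟩ t -
      simpa [h0, NNReal.dist_eq] using h.dist_le_mul t 0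
  · exact (LipschitzWith.uniformEquicontinuous _ 1 fun σ => σ.2.1).equicontinuous

theorem exists_tendsto_subseq_of_isSegment [ProperSpace X] {x₀ : X} {σ : ℕ → C(ℝ≥0, X)}
    {r : ℕ → ℝ} (hσ : ∀ k, IsSegment x₀ (σ k) (r k)) :
    ∃ τ : C(ℝ≥0, X), ∃ φ : ℕ → ℕ, StrictMono φ ∧ Tendsto (σ ∘ φ) atTop (𝓝 τ) := by
  obtain ⟨τ, -, φ, hφ, h⟩ := (isCompact_setOf_lipschitzWith x₀).tendsto_subseq
    fun k => ⟨(hσ k).lipschitzWith, (hσ k).2.1⟩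
  exact ⟨τ, φ, hφ, h⟩

/-- `h` is bounded on each initial segment of ℕ, crudely by the sum of its absolute values there. -/
theorem tendsto_atTop_of_comp_real {h : ℕ → ℝ} {m : ℕ → ℕ}
    (hm : Tendsto (fun k => h (m k)) atTop atTop) : Tendsto m atTop atTop := by
  refine tendsto_atTop.2 fun M => ?_
  filter_upwards [hm.eventually_gt_atTop (∑ i ∈ Finset.range M, |h i|)] with k hk
  by_contra! hlt
  have := Finset.single_le_sum (f := fun i => |h i|) (fun i _ => abs_nonneg _)
    (Finset.mem_range.2 hlt)
  linarith [le_abs_self (h (m k))]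

/-- Sequences converging to distinct ideal points have bounded mutual Gromov products. -/
theorem exists_gromovProduct_le [ProperSpace X] (hgeod : IsGeodesicSpace X) (hhyp : IsHyperbolic X)
    {x₀ : X} {y z : ℕ → X} {ξ ζ : GromovBoundary x₀}
    (hy : Tendsto (fun n => GromovClosure.point (x₀ := x₀) (y n)) atTop (𝓝 (.ideal ξ)))
    (hz : Tendsto (fun n => GromovClosure.point (x₀ := x₀) (z n)) atTop (𝓝 (.ideal ζ)))
    (hne : ξ ≠ ζ) :
    ∃ C : ℝ, ∀ m n, dist x₀ (y m) + dist x₀ (z n) - dist (y m) (z n) ≤ C := by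
  by_contra! hC
  -- Excess over 2k forces both endpoints to distance at least k, so both geodesics are still moving
  -- up to time k.
  choose m n hmn using fun k : ℕ => hC (2 * k)
  have hmy : ∀ k : ℕ, (k : ℝ) ≤ dist x₀ (y (m k)) := fun k => by
    have := dist_triangle x₀ (y (m k)) (z (n k))
    linarith [hmn k]
  have hnz : ∀ k : ℕ, (k : ℝ) ≤ dist x₀ (z (n k)) := fun k => by
    have := dist_triangle x₀ (z (n k)) (y (m k))
    rw [dist_comm (z (n k))] at this
    linarith [hmn k]
  have hm : Tendsto m atTop atTop := tendsto_atTop_of_comp_real (h := fun i => dist x₀ (y i))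
    (tendsto_atTop_mono hmy tendsto_natCast_atTop_atTop)
  have hn : Tendsto n atTop atTop := tendsto_atTop_of_comp_real (h := fun i => dist x₀ (z i))
    (tendsto_atTop_mono hnz tendsto_natCast_atTop_atTop)
  choose σ hσ using fun k => exists_isGeodesicTo_point hgeod x₀ (y (m k))
  choose ρ hρ using fun k => exists_isGeodesicTo_point hgeod x₀ (z (n k))
  have hσ' := fun k => isSegment_of_isGeodesicTo_point (hσ k)
  have hρ' := fun k => isSegment_of_isGeodesicTo_point (hρ k)
  obtain ⟨τ, φ, hφ, hτ⟩ := exists_tendsto_subseq_of_isSegment hσ'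
  obtain ⟨ω, ψ, hψ, hω⟩ := exists_tendsto_subseq_of_isSegment fun k => hρ' (φ k)
  have hτξ := isGeodesicTo_ideal_of_tendsto hgeod hy
    (hm.comp (hφ.tendsto_atTop.comp hψ.tendsto_atTop)) (fun k => hσ (φ (ψ k)))
    (hτ.comp hψ.tendsto_atTop)
  have hωζ := isGeodesicTo_ideal_of_tendsto hgeod hz
    (hn.comp (hφ.tendsto_atTop.comp hψ.tendsto_atTop)) (fun k => hρ (φ (ψ k))) hω
  obtain ⟨h1, rfl⟩ := hτξ
  obtain ⟨h2, rfl⟩ := hωζ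
  obtain ⟨δ, hδ, H⟩ := exists_dist_le_add_max hgeod hhyp
  refine hne (Quotient.sound ⟨2 * δ, fun t => ?_⟩)
  have hlim : Tendsto (fun k => dist (σ (φ (ψ k)) t) (ρ (φ (ψ k)) t)) atTop
      (𝓝 (dist (τ t) (ω t))) :=
    (((continuous_eval_const t).tendsto τ).comp (hτ.comp hψ.tendsto_atTop)).dist
      (((continuous_eval_const t).tendsto ω).comp hω)
  refine le_of_tendsto hlim ?_
  have hclose : ∀ᶠ k : ℕ in atTop, dist (σ k t) (ρ k t) ≤ 2 * δ := by
    filter_upwards [(tendsto_natCast_atTop_atTop (R := ℝ)).eventually_ge_atTop (t : ℝ)] with k hk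
    have hend : ∀ {y : X} {σ : C(ℝ≥0, X)}, IsGeodesicTo x₀ σ (.point y) → (t : ℝ) ≤ dist x₀ y →
        dist x₀ (σ t) = t ∧ dist (σ t) y = dist x₀ y - t := by
      intro y σ h hty
      have hs := isSegment_of_isGeodesicTo_point h
      refine ⟨by rw [hs.dist_base, min_eq_left hty], ?_⟩
      obtain ⟨R, -, -, hR⟩ := h
      have hyR := hR (max R (nndist x₀ y)) (le_max_left _ _)
      conv_lhs => rw [← hyR]
      rw [hs.2.2, min_eq_left hty, min_eq_right (by simp), abs_sub_comm, abs_of_nonneg (by linarith)]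
    obtain ⟨e1, e2⟩ := hend (hσ k) (hk.trans (hmy k))
    obtain ⟨e3, e4⟩ := hend (hρ k) (hk.trans (hnz k))
    -- The large product makes x₀ the dominant endpoint in `s1`, so σ(t) is at most δ farther from z
    -- than ρ(t) is; `s2` turns this into d(σ(t), ρ(t)) ≤ 2δ.
    have s1 := H (z (n k)) x₀ (y (m k)) (σ k t) (by linarith)
    have s2 := H (σ k t) x₀ (z (n k)) (ρ k t) (by linarith)
    rw [dist_comm (z (n k)) x₀, dist_comm (z (n k)) (y (m k)), dist_comm (z (n k)), e1, e2] at s1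
    rw [e3, e4, dist_comm (σ k t) x₀, e1] at s2
    have s3 : dist (σ k t) (z (n k)) ≤ δ + (dist x₀ (z (n k)) - t) :=
      s1.trans (add_le_add le_rfl (max_le le_rfl (by linarith [hmn k])))
    have s4 := s2.trans (add_le_add_right (max_le (c := δ) (by linarith) (by linarith)) δ)
    linarith
  exact (hφ.tendsto_atTop.comp hψ.tendsto_atTop).eventually hclose

end

end GromovHyp

/-! ### The main theorem. -/

open GromovHyp in
theorem mainTheorem8 {X : Type*} [MetricSpace X] [ProperSpace X]
    (hgeod : GromovHyp.IsGeodesicSpace X) (hhyp : GromovHyp.IsHyperbolic X)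
    (x₀ : X) (f g : X → X) (hf : LipschitzWith 1 f) (hg : LipschitzWith 1 g)
    (hfg : Function.Commute f g)
    (ξf ξg : GromovHyp.GromovBoundary x₀)
    (hξf : ∀ x : X, Tendsto (fun n : ℕ => GromovHyp.GromovClosure.point (x₀ := x₀) (f^[n] x))
      atTop (𝓝 (GromovHyp.GromovClosure.ideal ξf)))
    (hξg : ∀ x : X, Tendsto (fun n : ℕ => GromovHyp.GromovClosure.point (x₀ := x₀) (g^[n] x))
      atTop (𝓝 (GromovHyp.GromovClosure.ideal ξg)))
    (hne : ξg ≠ ξf) :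
    ∃ K : Set X, IsCompact K ∧
      ∀ m : ℕ, ∃ n : ℕ, (K ∩ (f^[m] ∘ g^[n]) '' K).Nonempty := by
  obtain ⟨C, hC⟩ := exists_gromovProduct_le hgeod hhyp (hξf x₀) (hξg x₀) hne.symm
  obtain ⟨δ, hδ, H⟩ := exists_dist_le_add_max hgeod hhyp
  have hiter : ∀ {h : X → X}, LipschitzWith 1 h → ∀ (n : ℕ) (x y : X),
      dist (h^[n] x) (h^[n] y) ≤ dist x y := fun hh n x y => by
    simpa using (hh.iterate n).dist_le_mul x y
  have hC0 : 0 ≤ C := by simpa using hC 0 0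
  set D := dist x₀ (g x₀) with hD
  have hD0 : 0 ≤ D := dist_nonneg
  -- The radius adds d(w,u) ≤ δ + C + D and d(x₀,u) ≤ δ + C.
  refine ⟨Metric.closedBall x₀ (2 * δ + 2 * C + D), isCompact_closedBall _ _, fun m => ?_⟩
  classical
  -- The first n at which the g-orbit is as far out as f^m(x₀); one step of g moves the orbit by at
  -- most D.
  obtain ⟨n, hn1, hn2⟩ : ∃ n, dist x₀ (f^[m] x₀) ≤ dist x₀ (g^[n] x₀) ∧
      dist x₀ (g^[n] x₀) ≤ dist x₀ (f^[m] x₀) + D := by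
    have hex : ∃ n, dist x₀ (f^[m] x₀) ≤ dist x₀ (g^[n] x₀) :=
      (exists_lt_dist_of_tendsto_ideal hgeod (hξg x₀) _).imp fun _ => le_of_lt
    refine ⟨Nat.find hex, Nat.find_spec hex, ?_⟩
    rcases h : Nat.find hex with _ | k
    · simp only [Function.iterate_zero, id, dist_self]
      positivity
    · have hk := Nat.find_min hex (m := k) (by omega)
      have h1 := hiter hg k x₀ (g x₀)
      rw [← Function.iterate_succ_apply] at h1
      have h2 := dist_triangle x₀ (g^[k] x₀) (g^[k + 1] x₀)
      push Not at hk
      linarith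
  refine ⟨n, f^[m] (g^[n] x₀), ?_, x₀, Metric.mem_closedBall_self (by positivity), rfl⟩
  set p := f^[m] x₀
  set q := g^[n] x₀
  set w := f^[m] q with hw
  have hwp : dist w p ≤ dist x₀ q := by
    rw [dist_comm x₀]
    exact hiter hf m q x₀
  have hwq : dist w q ≤ dist x₀ p := by
    rw [hw, show f^[m] q = g^[n] p from (hfg.iterate_iterate m n) x₀, dist_comm x₀]
    exact hiter hg n p x₀
  have hpq := hC m n
  -- Ideally s = d(x₀,p); truncating at d(p,q) costs at most C by the product bound.
  obtain ⟨s, hs0, hsL, hsa, hsC⟩ : ∃ s, 0 ≤ s ∧ s ≤ dist p q ∧ s ≤ dist x₀ p ∧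
      dist x₀ p - C ≤ s :=
    ⟨min (dist x₀ p) (dist p q), le_min dist_nonneg dist_nonneg, min_le_right _ _, min_le_left _ _,
      le_min (by linarith) (by linarith [@dist_nonneg _ _ x₀ q])⟩
  obtain ⟨u, hpu, huq⟩ : ∃ u, dist p u = s ∧ dist u q = dist p q - s := by
    obtain ⟨a, b, γ, hab, hγ, ha, hb⟩ := hgeod p q
    have hL := hγ.dist_eq_sub le_rfl hab le_rfl
    rw [ha, hb] at hL
    have h1 := hγ.dist_eq_sub (t := a + s) le_rfl (by linarith) (by linarith)
    have h2 := hγ.dist_eq_sub (s := a + s) (by linarith) (by linarith) le_rfl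
    rw [ha] at h1
    rw [hb] at h2
    exact ⟨γ (a + s), by linarith, by linarith⟩
  have hu : dist p u + dist u q = dist p q := by linarith
  have k1 := H w p q u hu
  have k2 := H x₀ p q u hu
  have k3 := k1.trans (add_le_add_right (max_le (c := C + D) (by linarith) (by linarith)) δ)
  have k4 := k2.trans (add_le_add_right (max_le (c := C) (by linarith) (by linarith)) δ)
  rw [Metric.mem_closedBall]
  have := dist_triangle w u x₀
  rw [dist_comm u x₀] at this
  linarith
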